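/- **Setting.** Let $\mathcal V$ be a finite set of $n=|\mathcal V|$ agents and $\bar h\ge 0$. Let $A(t)=(a_{ij}(t))_{i,j\in\mathcal V}$, $t\ge0$, have nonnegative entries that are locally $L_1$-summable on $[0,\infty)$. A family of admissible delays is a family of Lebesgue measurable functions $h_{ij}:[0,\infty)\to[0,\bar h]$. Consider $$\dot x_i(t)=\sum_{j\ne i}a_{ij}(t)\bigl(x_j(t-h_{ij}(t))-x_i(t)\bigr),\qquad i\in\mathcal V. \tag{1}$$ A solution started at $t_*\ge 0$ is a function $x$ that is bounded and measurable on $[t_*-\bar h,t_*)$ (arbitrary history), locally absolutely continuous on $[t_*,\infty)$ (a jump at $t_*$ is allowed), and satisfies (1) for almost all $t>t_*$. Put $$\lambda(t)=\inf_{t-\bar h\le s\le t}\min_i x_i(s),\qquad \Lambda(t)=\sup_{t-\bar h\le s\le t}\max_i x_i(s).$$ Global consensus is established if for every $t_*\ge0$ and every solution started at $t_*$ the limits $\bar x_i=\lim_{t\to\infty}x_i(t)$ exist and are all equal; then $\bar x=(\bar x_i)_{i\in\mathcal V}$. For a nonnegative matrix $W$ and $\varepsilon>0$, let $W$ be called quasi-strongly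 $\varepsilon$-connected if in the directed graph with arcs $j\to i$ whenever $w_{ij}\ge\varepsilon$ some node is connected to all other nodes by directed walks. An *AQSC sequence* of $A(\cdot)$ for $\varepsilon>0$ is a strictly increasing sequence $0\le t_0<t_1<\dots$, $t_p\to\infty$, such that (i) $\int_{t_p}^{t_{p+1}}A(s)\,ds$ is quasi-strongly $\varepsilon$-connected for every $p$, and (ii) $\sup_{p,\,i\ne j}\int_{t_p}^{t_{p+1}}a_{ij}(s)\,ds<\infty$. The function $A(\cdot)$ is *aperiodically quasi-strongly connected* (AQSC) if it has an AQSC sequence for some $\varepsilon>0$. For a sequence $(t_p)$, a positive integer $m$ and $\theta\in(0,1)$, say that (1) *contracts along $(t_p)$ over blocks of $m$ intervals with factor $\theta$* if every solution, started at any $t_*\ge 0$, converges to a consensus vector $\bar x$, and for every index $r$ with $t_r\ge t_*$ $$\|x(t)-\bar x\|_\infty\le\Lambda(t)-\lambda(t)\le\theta^k\bigl(\Lambda(t_*)-\lambda(t_*)\bigr)\qquad\forall k\ge0,\ \forall t\in[t_{r+km},\,t_{r+(k+1)m}].$$ For $m=0$ the same definition is used. **Theorem.** Suppose that $A(\cdot)$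 is AQSC and that at least one of the following holds: (a) $\sup_{t\ge0,\ i,j\in\mathcal V}\int_t^{t+D}a_{ij}(s)\,ds<\infty$ for every $D>0$; (b) $\bar h=0$ (no delays). Then: 1. For all admissible delays, (1) establishes global consensus. 2. Let $n\ge2$ and let $(t_p)$ be an AQSC sequence of $A(\cdot)$ for $\varepsilon$. There is an integer $N\ge1$, which does not depend on the delays $h_{ij}$ but only on their bound $\bar h$, such that $(t_{Np})_{p\ge0}$ is an AQSC sequence for $\varepsilon$ with steps $t_{N(p+1)}-t_{Np}\ge\bar h$, and for all admissible delays there is $\theta\in(0,1)$ such that (1) contracts along $(t_{Np})$ over blocks of $2(n-1)$ intervals with factor $\theta$. 3. If $(t_p)$ is an AQSC sequence with $t_{p+1}-t_p\ge\bar h$ for all $p$, then for all admissible delays there is $\theta\in(0,1)$ such that (1) contracts along $(t_p)$ itself over blocks of $2n-1$ intervals with factor $\theta$. 4. If $\bar h=0$ and $(t_p)$ is any AQSC sequence, then there is $\theta\in(0,1)$ such that (1) contracts along $(t_p)$ itself over blocks of $2(n-1)$ intervals with factor $\theta$. In 2-4 the factor $\theta$ does not depend on $t_*$, $r$, $k$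 or the solution. -/

import Mathlib

open MeasureTheory Set Filter Topology

namespace DelayedConsensus

/-! ### Weighted directed graphs -/

/-- The directed graph `𝒢[W]` of a nonnegative weight matrix `W`: there is an arc from `j` to `i`
(agent `j` influences agent `i`) if and only if `W i j > 0`. -/
def graphOf {V : Type*} (W : Matrix V V ℝ) : Digraph V where
  Adj j i := 0 < W i j

/-- `W^[ε]`: the entries of `W` smaller than `ε` are replaced by zero. -/
noncomputable def truncate {V : Type*} (ε : ℝ) (W : Matrix V V ℝ) : Matrix V V ℝ :=
  Matrix.of fun i j => if ε ≤ W i j then W i j else 0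

/-- A directed graph is quasi-strongly connected if some node (a root) is connected to all other
nodes by directed walks. -/
def QuasiStronglyConnected {V : Type*} (G : Digraph V) : Prop :=
  ∃ root : V, ∀ i : V, Relation.ReflTransGen G.Adj root i

/-- `𝒢[W]` is quasi-strongly `ε`-connected if its `ε`-skeleton `𝒢[W^[ε]]` is quasi-strongly
connected. -/
def QuasiStronglyEpsConnected {V : Type*} (ε : ℝ) (W : Matrix V V ℝ) : Prop :=
  QuasiStronglyConnected (graphOf (truncate ε W))

/-! ### Weights and delays -/

/-- Standing assumption on the weights: `a_ij ≥ 0` on `[0, ∞)`, and `a_ij` is locally summable on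
`[0, ∞)`. -/
structure AdmissibleWeights {V : Type*} (A : ℝ → Matrix V V ℝ) : Prop where
  nonneg : ∀ t, 0 ≤ t → ∀ i j, 0 ≤ A t i j
  locallyIntegrable : ∀ i j, LocallyIntegrableOn (fun t => A t i j) (Ici 0) volume

/-- Standing assumption on the delays: `h_ij(t) ∈ [0, hbar]` for `t ≥ 0`, and `h_ij` is Lebesgue
measurable on `[0, ∞)`. -/
structure AdmissibleDelays {V : Type*} (hbar : ℝ) (h : ℝ → V → V → ℝ) : Prop where
  mem_Icc : ∀ t, 0 ≤ t → ∀ i j, h t i j ∈ Icc 0 hbar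
  aemeasurable : ∀ i j, AEMeasurable (fun t => h t i j) (volume.restrict (Ici 0))

/-- The uniform local integral bound: for every `D > 0`,
`sup { ∫_t^{t+D} a_ij(s) ds : t ≥ 0, i, j } < ∞`. -/
def UniformIntegralBound {V : Type*} (A : ℝ → Matrix V V ℝ) : Prop :=
  ∀ D : ℝ, 0 < D → ∃ μ : ℝ, ∀ t, 0 ≤ t → ∀ i j, ∫ s in t..(t + D), A s i j ≤ μ

/-- The entrywise integral `A_{t₁}^{t₂} = ∫_{t₁}^{t₂} A(s) ds`. -/
noncomputable def integralMatrix {V : Type*} (A : ℝ → Matrix V V ℝ) (t₁ t₂ : ℝ) : Matrix V V ℝ :=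
  Matrix.of fun i j => ∫ s in t₁..t₂, A s i j

/-- `A(·)` is `t`-bounded: the off-diagonal entries of its integrals over the intervals
`[t_p, t_{p+1}]` are bounded uniformly in `p`. -/
def IsSeqBounded {V : Type*} (A : ℝ → Matrix V V ℝ) (t : ℕ → ℝ) : Prop :=
  ∃ ℓ : ℝ, ∀ p : ℕ, ∀ i j, i ≠ j → ∫ s in (t p)..(t (p + 1)), A s i j ≤ ℓ

/-- `ε` and the sequence `t` witness that `A(·)` is aperiodically quasi-strongly connected. -/
structure IsAQSCSequence {V : Type*} (A : ℝ → Matrix V V ℝ) (ε : ℝ) (t : ℕ → ℝ) : Prop where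
  eps_pos : 0 < ε
  nonneg : ∀ p, 0 ≤ t p
  strictMono : StrictMono t
  tendsto : Tendsto t atTop atTop
  connected : ∀ p, QuasiStronglyEpsConnected ε (integralMatrix A (t p) (t (p + 1)))
  bounded : IsSeqBounded A t

/-- Aperiodic quasi-strong connectivity (AQSC). -/
def IsAQSC {V : Type*} (A : ℝ → Matrix V V ℝ) : Prop :=
  ∃ (ε : ℝ) (t : ℕ → ℝ), IsAQSCSequence A ε t

/-! ### The delayed averaging dynamics -/

/-- `x` is a (Carathéodory) solution, started at time `tstar ≥ 0`, of
`x_i'(t) = ∑_{j ≠ i} a_ij(t) (x_j(t - h_ij(t)) - x_i(t))`: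
the initial history on `[tstar - hbar, tstar)` is an arbitrary bounded measurable function, and on
`[tstar, ∞)` the function `x` is locally absolutely continuous and obeys the equation almost
everywhere. A jump of `x` at `tstar` from the left is allowed. Values of `x` before
`tstar - hbar` are irrelevant. -/
structure IsSolution {V : Type*} [Fintype V] [DecidableEq V] (A : ℝ → Matrix V V ℝ)
    (hbar : ℝ) (h : ℝ → V → V → ℝ) (tstar : ℝ) (x : ℝ → V → ℝ) : Prop where
  history_bounded : ∃ C : ℝ, ∀ s ∈ Ico (tstar - hbar) tstar, ∀ i, |x s i| ≤ C
  history_measurable : ∀ i,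
    AEMeasurable (fun s => x s i) (volume.restrict (Ico (tstar - hbar) tstar))
  absolutelyContinuous : ∀ T, tstar ≤ T → ∀ i,
    AbsolutelyContinuousOnInterval (fun s => x s i) tstar T
  equation : ∀ i, ∀ᵐ s ∂(volume.restrict (Ioi tstar)),
    HasDerivAt (fun u => x u i)
      (∑ j ∈ Finset.univ.erase i, A s i j * (x (s - h s i j) j - x s i)) s

/-- Consensus is established in the group of agents `S`: for every starting time and every
solution, the agents of `S` have ultimate values, and these coincide. -/
def EstablishesConsensus {V : Type*} [Fintype V] [DecidableEq V] (A : ℝ → Matrix V V ℝ)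
    (hbar : ℝ) (h : ℝ → V → V → ℝ) (S : Set V) : Prop :=
  ∀ tstar : ℝ, 0 ≤ tstar → ∀ x : ℝ → V → ℝ, IsSolution A hbar h tstar x →
    ∃ xbar : V → ℝ, (∀ i ∈ S, Tendsto (fun t => x t i) atTop (𝓝 (xbar i))) ∧
      ∀ i ∈ S, ∀ j ∈ S, xbar i = xbar j

/-- Global consensus: consensus in the group of all agents. -/
def EstablishesGlobalConsensus {V : Type*} [Fintype V] [DecidableEq V] (A : ℝ → Matrix V V ℝ)
    (hbar : ℝ) (h : ℝ → V → V → ℝ) : Prop :=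
  EstablishesConsensus A hbar h univ

/-- `λ(t)`: the infimum of all agents' values over the window `[t - hbar, t]`. -/
noncomputable def windowInf {V : Type*} (hbar : ℝ) (x : ℝ → V → ℝ) (t : ℝ) : ℝ :=
  sInf {y : ℝ | ∃ s ∈ Icc (t - hbar) t, ∃ i : V, x s i = y}

/-- `Λ(t)`: the supremum of all agents' values over the window `[t - hbar, t]`. -/
noncomputable def windowSup {V : Type*} (hbar : ℝ) (x : ℝ → V → ℝ) (t : ℝ) : ℝ :=
  sSup {y : ℝ | ∃ s ∈ Icc (t - hbar) t, ∃ i : V, x s i = y}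

/-- The diameter `Λ(t) - λ(t)`. -/
noncomputable def diameter {V : Type*} (hbar : ℝ) (x : ℝ → V → ℝ) (t : ℝ) : ℝ :=
  windowSup hbar x t - windowInf hbar x t

/-- Contraction with factor `θ` over blocks of `m` consecutive intervals of the sequence `t`:
every solution `x` (with any starting time `tstar ≥ 0`) converges to a consensus vector
`xbar = (c, …, c)`, and for every index `r` with `t_r ≥ tstar`, every `k ≥ 0` and every
`s ∈ [t_{r+km}, t_{r+(k+1)m}]`,
`‖x(s) - xbar‖_∞ ≤ Λ(s) - λ(s) ≤ θ^k (Λ(tstar) - λ(tstar))`.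
The norm on `V → ℝ` is the maximum norm. -/
def ContractsAlong {V : Type*} [Fintype V] [DecidableEq V] (A : ℝ → Matrix V V ℝ)
    (hbar : ℝ) (h : ℝ → V → V → ℝ) (t : ℕ → ℝ) (θ : ℝ) (m : ℕ) : Prop :=
  ∀ tstar : ℝ, 0 ≤ tstar → ∀ x : ℝ → V → ℝ, IsSolution A hbar h tstar x →
    ∃ c : ℝ, (∀ i, Tendsto (fun s => x s i) atTop (𝓝 c)) ∧
      ∀ r : ℕ, tstar ≤ t r → ∀ k : ℕ, ∀ s ∈ Icc (t (r + k * m)) (t (r + (k + 1) * m)),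
        ‖x s - fun _ => c‖ ≤ diameter hbar x s ∧
          diameter hbar x s ≤ θ ^ k * diameter hbar x tstar

end DelayedConsensus

/-!
The dynamics are order preserving and commute with affine maps of the values, so upper and lower
bounds are both instances of statements about nonnegative solutions. For such a solution, the
integrating factor `exp (∫ ∑_{j ≠ i} a_ij)` turns the equation into the estimate
`IsSolution.add_sum_mul_integral_le`: an agent keeps a fixed fraction of its own value, and collects
at least `c ∫ a_ij` from an agent `j` whose delayed value stays above `c`. It yields

* the minimum principle (`IsSolution.nonneg_of_window`), hence the monotonicity of `λ` and `Λ`;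
* the persistence of a lower bound over an interval of the sequence (`IsSolution.exp_neg_mul_le`);
* the spreading of a lower bound along an arc of weight at least `ε` (`IsSolution.le_of_arc`), which
  takes two intervals: the first one, of length at least `hbar`, ensures that the delayed values of
  the second one obey the bound.

At time `t_r`, let `S` be the agents at or above the midpoint of `[λ(t_r), Λ(t_r)]` and `T` those at
or below it. The sets cover `V`. As long as neither is all of `V`, the root of the next graph, which
may change from interval to interval, lies in `S` or in `T`, and that set gains an agent through
an arc that leaves it. Since `|S| + |T| ≥ n` at the start, one of the sets is `V` after `n - 1`
rounds, that is `2 (n - 1)` intervals (`IsSolution.forall_le_or_forall_le`): all agents are then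
away from one end of the initial range by a definite fraction of its length. One further interval
extends this to the window of length `hbar`; without delays the window is a point and nothing is to
be added. So the diameter shrinks by a fixed factor (`IsSolution.diameter_le_contractionFactor_mul`),
and consensus with a geometric rate follows (`contractsAlong_of_diameter_le`).

The uniform integral bound ensures that boundedly many intervals fit into the time `hbar`
(`IsAQSCSequence.exists_le_sub`). Merging `N` of them makes the steps at least `hbar`; merging `2 N`
of them also makes `2 (n - 1)` merged intervals contain the required `2 n - 1` groups.
-/

namespace DelayedConsensus

/-! ### A comparison lemma for absolutely continuous functions -/

theorem _root_.LipschitzOnWith.comp_absolutelyContinuousOnInterval {f g : ℝ → ℝ} {K : NNReal}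
    {a b : ℝ} {s : Set ℝ} (hg : LipschitzOnWith K g s) (hf : AbsolutelyContinuousOnInterval f a b)
    (hfs : MapsTo f (uIcc a b) s) :
    AbsolutelyContinuousOnInterval (fun x => g (f x)) a b := by
  rw [absolutelyContinuousOnInterval_iff] at hf ⊢
  intro ε hε
  obtain ⟨δ, hδ, H⟩ := hf (ε / (K + 1)) (by positivity)
  refine ⟨δ, hδ, fun E hE hlen => ?_⟩
  have h1 := H E hE hlen
  calc _ ≤ ∑ i ∈ Finset.range E.1, K * dist (f (E.2 i).1) (f (E.2 i).2) := by
        refine Finset.sum_le_sum fun i hi => ?_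
        have := hE.1 i hi
        exact hg.dist_le_mul _ (hfs this.1) _ (hfs this.2)
    _ = K * ∑ i ∈ Finset.range E.1, dist (f (E.2 i).1) (f (E.2 i).2) := by
        rw [Finset.mul_sum]
    _ ≤ K * (ε / (K + 1)) := by gcongr
    _ < (K + 1) * (ε / (K + 1)) := by
        have : 0 < ε / ((K : ℝ) + 1) := by positivity
        linarith
    _ = ε := by field_simp

theorem _root_.AbsolutelyContinuousOnInterval.exp {f : ℝ → ℝ} {a b : ℝ}
    (hf : AbsolutelyContinuousOnInterval f a b) :
    AbsolutelyContinuousOnInterval (fun x => Real.exp (f x)) a b := by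
  obtain ⟨C, hC⟩ := hf.exists_bound
  obtain ⟨K, hK⟩ := (Real.contDiff_exp.contDiffOn (s := Icc (-C) C)).exists_lipschitzOnWith
    one_ne_zero (convex_Icc _ _) isCompact_Icc
  exact hK.comp_absolutelyContinuousOnInterval hf
    fun x hx => abs_le.1 (hC x hx)

/-- Integrated form of the differential inequality `u' ≥ g - α u` with `α, g ≥ 0`: multiply by the
integrating factor `exp (∫ α)`, which is at least `1`. -/
theorem add_integral_le_exp_mul {u α g d : ℝ → ℝ} {a b : ℝ} (hab : a ≤ b)
    (hu : AbsolutelyContinuousOnInterval u a b)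
    (hα : IntervalIntegrable α volume a b) (hα0 : ∀ s ∈ Icc a b, 0 ≤ α s)
    (hg : IntervalIntegrable g volume a b) (hg0 : ∀ s ∈ Icc a b, 0 ≤ g s)
    (hd : ∀ᵐ s, s ∈ Ioc a b → HasDerivAt u (d s) s ∧ g s - α s * u s ≤ d s) :
    u a + ∫ s in a..b, g s ≤ Real.exp (∫ s in a..b, α s) * u b := by
  set B : ℝ → ℝ := fun t => ∫ s in a..t, α s with hB
  have hBac : AbsolutelyContinuousOnInterval B a b :=
    hα.absolutelyContinuousOnInterval_intervalIntegral left_mem_uIcc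
  have hfac := hBac.exp.fun_mul hu
  have hBd := hα.ae_hasDerivAt_integral
  have key : ∫ s in a..b, g s ≤ ∫ s in a..b, deriv (fun t => Real.exp (B t) * u t) s := by
    refine intervalIntegral.integral_mono_ae_restrict hab hg hfac.intervalIntegrable_deriv ?_
    rw [EventuallyLE, ae_restrict_iff' measurableSet_Icc]
    have hne : ∀ᵐ s : ℝ, s ≠ a := Measure.ae_ne volume a
    filter_upwards [hBd, hd, hne] with s hs1 hs2 hsa hs
    have hs' : s ∈ uIcc a b := by rwa [uIcc_of_le hab]
    obtain ⟨hu', hle⟩ := hs2 ⟨lt_of_le_of_ne hs.1 hsa.symm, hs.2⟩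
    have hB' : HasDerivAt B (α s) s := hs1 hs' a left_mem_uIcc
    rw [(hB'.exp.fun_mul hu').deriv]
    have hB0 : 0 ≤ B s := intervalIntegral.integral_nonneg hs.1 fun r hr =>
      hα0 r ⟨hr.1, hr.2.trans hs.2⟩
    have he : 1 ≤ Real.exp (B s) := Real.one_le_exp hB0
    have hgs := hg0 s hs
    nlinarith [mul_le_mul_of_nonneg_left hle (Real.exp_pos (B s)).le]
  rw [hfac.integral_deriv_eq_sub] at key
  have hBa : B a = 0 := intervalIntegral.integral_same
  simp only [hBa, Real.exp_zero, one_mul] at key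
  linarith

/-! ### Solutions of the averaging dynamics -/

theorem AdmissibleWeights.intervalIntegrable {V : Type*} {A : ℝ → Matrix V V ℝ}
    (hA : AdmissibleWeights A) {a b : ℝ} (ha : 0 ≤ a)
    (hb : 0 ≤ b) (i j : V) : IntervalIntegrable (fun s => A s i j) volume a b := by
  refine IntegrableOn.intervalIntegrable ?_
  refine (hA.locallyIntegrable i j).integrableOn_compact_subset ?_ isCompact_uIcc
  intro s hs
  exact (le_min ha hb).trans hs.1

theorem AdmissibleWeights.integral_mono {V : Type*} {A : ℝ → Matrix V V ℝ}
    (hA : AdmissibleWeights A) {a b a' b' : ℝ} (ha : 0 ≤ a)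
    (haa : a ≤ a') (hab : a' ≤ b') (hbb : b' ≤ b) (i j : V) :
    ∫ s in a'..b', A s i j ≤ ∫ s in a..b, A s i j := by
  refine intervalIntegral.integral_mono_interval haa hab hbb ?_
    (hA.intervalIntegrable ha (by linarith) i j)
  rw [EventuallyLE, ae_restrict_iff' measurableSet_Ioc]
  exact ae_of_all _ fun s hs => hA.nonneg s (ha.trans hs.1.le) i j

section Dynamics

variable {V : Type*} [Fintype V] [DecidableEq V] {A : ℝ → Matrix V V ℝ} {hbar : ℝ}
  {h : ℝ → V → V → ℝ} {tstar : ℝ} {x : ℝ → V → ℝ}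

/-- The total weight `∑_{j ≠ i} a_ij(s)` of the influences on agent `i`. The diagonal entry of
`A s`, which does not enter the dynamics, is left out. -/
noncomputable def totalWeight (A : ℝ → Matrix V V ℝ) (i : V) (s : ℝ) : ℝ :=
  ∑ j ∈ Finset.univ.erase i, A s i j

theorem integral_totalWeight (hA : AdmissibleWeights A) {a b : ℝ} (ha : 0 ≤ a) (hb : 0 ≤ b)
    (i : V) : ∫ s in a..b, totalWeight A i s = ∑ j ∈ Finset.univ.erase i, ∫ s in a..b, A s i j :=
  intervalIntegral.integral_finsetSum fun j _ => hA.intervalIntegrable ha hb i j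

theorem integral_totalWeight_mono (hA : AdmissibleWeights A) {a b a' b' : ℝ} (ha : 0 ≤ a)
    (haa : a ≤ a') (hab : a' ≤ b') (hbb : b' ≤ b) (i : V) :
    ∫ s in a'..b', totalWeight A i s ≤ ∫ s in a..b, totalWeight A i s := by
  rw [integral_totalWeight hA (by linarith) (by linarith),
    integral_totalWeight hA ha (by linarith)]
  exact Finset.sum_le_sum fun j _ => hA.integral_mono ha haa hab hbb i j

/-- The dynamics only involve differences of values, so affine images of solutions are solutions.
This is what makes the bounds from above and from below two instances of one statement. -/
theorem IsSolution.affine (hx : IsSolution A hbar h tstar x) (a b : ℝ) :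
    IsSolution A hbar h tstar (fun s i => a * x s i + b) where
  history_bounded := by
    obtain ⟨C, hC⟩ := hx.history_bounded
    refine ⟨|a| * C + |b|, fun s hs i => (abs_add_le _ _).trans ?_⟩
    rw [abs_mul]
    gcongr
    exact hC s hs i
  history_measurable i := ((hx.history_measurable i).const_mul a).add_const b
  absolutelyContinuous T hT i := by
    refine ((hx.absolutelyContinuous T hT i).const_mul a).fun_add ?_
    exact (LipschitzWith.const (α := ℝ) b).lipschitzOnWith.absolutelyContinuousOnInterval
  equation i := by
    filter_upwards [hx.equation i] with s hs
    convert! (hs.const_mul a).add_const b using 1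
    rw [Finset.mul_sum]
    exact Finset.sum_congr rfl fun j _ => by ring

theorem IsSolution.continuousOn (hx : IsSolution A hbar h tstar x) {T : ℝ} (hT : tstar ≤ T)
    (i : V) : ContinuousOn (fun s => x s i) (Icc tstar T) := by
  rw [← uIcc_of_le hT]
  exact (hx.absolutelyContinuous T hT i).continuousOn

/-- Lower bounds `c j` for the values over the delayed window propagate: the agent `i` forgets its
own value `x_i(a)` at most at the rate of its total weight, and collects `c j ∫ a_ij` from each of
the other agents. -/
theorem IsSolution.add_sum_mul_integral_le (hA : AdmissibleWeights A)
    (hh : AdmissibleDelays hbar h) (hx : IsSolution A hbar h tstar x) (h0 : 0 ≤ tstar)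
    {a b : ℝ} (ha : tstar ≤ a) (hab : a ≤ b) {c : V → ℝ} (hc : ∀ j, 0 ≤ c j)
    (hcx : ∀ s ∈ Icc (a - hbar) b, ∀ j, c j ≤ x s j) (i : V) :
    x a i + ∑ j ∈ Finset.univ.erase i, c j * ∫ s in a..b, A s i j ≤
      Real.exp (∫ s in a..b, totalWeight A i s) * x b i := by
  have ha0 : 0 ≤ a := h0.trans ha
  have hb0 : 0 ≤ b := ha0.trans hab
  have hint : ∀ j, IntervalIntegrable (fun s => A s i j) volume a b :=
    fun j => hA.intervalIntegrable ha0 hb0 i j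
  have hlin : ∀ w : V → ℝ, IntervalIntegrable
      (fun s => ∑ j ∈ Finset.univ.erase i, w j * A s i j) volume a b := fun w => by
    simpa only [Finset.sum_fn] using
      IntervalIntegrable.sum (Finset.univ.erase i) fun j _ => (hint j).const_mul (w j)
  have hsum : ∑ j ∈ Finset.univ.erase i, c j * ∫ s in a..b, A s i j =
      ∫ s in a..b, ∑ j ∈ Finset.univ.erase i, c j * A s i j := by
    rw [intervalIntegral.integral_finsetSum fun j _ => (hint j).const_mul (c j)]
    exact Finset.sum_congr rfl fun j _ => (intervalIntegral.integral_const_mul _ _).symm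
  rw [hsum]
  refine add_integral_le_exp_mul (u := fun s => x s i) hab
    ((hx.absolutelyContinuous b (ha.trans hab) i).mono ?_)
    (by simpa only [Pi.one_apply, one_mul] using! hlin 1)
    (fun s hs => Finset.sum_nonneg fun j _ => hA.nonneg s (ha0.trans hs.1) i j)
    (hlin c)
    (fun s hs => Finset.sum_nonneg fun j _ =>
      mul_nonneg (hc j) (hA.nonneg s (ha0.trans hs.1) i j))
    (d := fun s => ∑ j ∈ Finset.univ.erase i, A s i j * (x (s - h s i j) j - x s i)) ?_
  · rw [uIcc_of_le hab, uIcc_of_le (ha.trans hab)]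
    exact Icc_subset_Icc_left ha
  · have heq := hx.equation i
    rw [ae_restrict_iff' measurableSet_Ioi] at heq
    filter_upwards [heq] with s hs hsab
    have hs0 : 0 ≤ s := ha0.trans hsab.1.le
    refine ⟨hs (ha.trans_lt hsab.1), ?_⟩
    rw [totalWeight, Finset.sum_mul, ← Finset.sum_sub_distrib]
    refine Finset.sum_le_sum fun j _ => ?_
    have hd := hh.mem_Icc s hs0 i j
    have h1 := hcx (s - h s i j) ⟨by linarith [hd.2, hsab.1], by linarith [hd.1, hsab.2]⟩ j
    nlinarith [mul_le_mul_of_nonneg_left h1 (hA.nonneg s hs0 i j)]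

theorem IsSolution.le_exp_mul (hA : AdmissibleWeights A)
    (hh : AdmissibleDelays hbar h) (hx : IsSolution A hbar h tstar x) (h0 : 0 ≤ tstar)
    {a b : ℝ} (ha : tstar ≤ a) (hab : a ≤ b)
    (hnn : ∀ s ∈ Icc (a - hbar) b, ∀ j, 0 ≤ x s j) (i : V) :
    x a i ≤ Real.exp (∫ s in a..b, totalWeight A i s) * x b i := by
  simpa using hx.add_sum_mul_integral_le hA hh h0 ha hab (c := 0) (fun _ => le_rfl) hnn i

/-- Minimum principle: a solution that is nonnegative over a window stays nonnegative. If its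
least value up to some later time were `-P < 0`, then `x + P` would be nonnegative up to that time
and vanish at some point after having been positive, contrary to the exponential lower bound. -/
theorem IsSolution.nonneg_of_window (hA : AdmissibleWeights A) (hbar0 : 0 ≤ hbar)
    (hh : AdmissibleDelays hbar h) (hx : IsSolution A hbar h tstar x) (h0 : 0 ≤ tstar)
    {a : ℝ} (ha : tstar ≤ a) (hnn : ∀ s ∈ Icc (a - hbar) a, ∀ j, 0 ≤ x s j)
    {s : ℝ} (hs : a - hbar ≤ s) (i : V) : 0 ≤ x s i := by
  by_contra! hneg
  have has : a < s := by
    by_contra! hle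
    exact absurd (hnn s ⟨hs, hle⟩ i) hneg.not_ge
  have hmin : ∀ j, ∃ r ∈ Icc a s, ∀ r' ∈ Icc a s, x r j ≤ x r' j := fun j =>
    isCompact_Icc.exists_isMinOn (nonempty_Icc.2 has.le)
      ((hx.continuousOn (ha.trans has.le) j).mono (Icc_subset_Icc_left ha))
  choose r hr hrmin using hmin
  obtain ⟨j, -, hj⟩ :=
    Finset.exists_min_image Finset.univ (fun j => x (r j) j) ⟨i, Finset.mem_univ i⟩
  have hP : x (r j) j < 0 :=
    ((hj i (Finset.mem_univ i)).trans (hrmin i s (right_mem_Icc.2 has.le))).trans_lt hneg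
  have hy := hx.affine 1 (-x (r j) j)
  have hle := hy.le_exp_mul hA hh h0 ha (hr j).1 (fun r' hr' k => by
    rcases le_total r' a with hra | hra
    · have := hnn r' ⟨hr'.1, hra⟩ k
      linarith
    · have := (hj k (Finset.mem_univ k)).trans (hrmin k r' ⟨hra, hr'.2.trans (hr j).2⟩)
      linarith) j
  have := hnn a ⟨by linarith, le_rfl⟩ j
  simp only [one_mul, add_neg_cancel, mul_zero] at hle
  linarith

/-- An agent's lower bound decays at most by the factor `exp (-L)` over a time interval on which
its total weight integrates to at most `L`. -/
theorem IsSolution.exp_neg_mul_le (hA : AdmissibleWeights A)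
    (hh : AdmissibleDelays hbar h) (hx : IsSolution A hbar h tstar x) (h0 : 0 ≤ tstar)
    {a b : ℝ} (ha : tstar ≤ a) (hnn : ∀ s, a - hbar ≤ s → ∀ j, 0 ≤ x s j) {i : V} {L : ℝ}
    (hL : ∫ s in a..b, totalWeight A i s ≤ L) (hbar0 : 0 ≤ hbar)
    {c : ℝ} (hc : c ≤ x a i) {s : ℝ} (hs : s ∈ Icc a b) :
    Real.exp (-L) * c ≤ x s i := by
  have h1 := hx.le_exp_mul hA hh h0 ha hs.1 (fun r hr => hnn r hr.1) i
  have h2 := integral_totalWeight_mono hA (h0.trans ha) le_rfl hs.1 hs.2 i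
  have h3 : 0 ≤ x s i := hnn s (by linarith [hs.1]) i
  have h4 : c ≤ Real.exp L * x s i :=
    hc.trans (h1.trans (mul_le_mul_of_nonneg_right (Real.exp_le_exp.2 (h2.trans hL)) h3))
  rw [Real.exp_neg, inv_mul_le_iff₀ (Real.exp_pos L)]
  exact h4

/-- A lower bound spreads along an arc. The first interval `[a, b]`, of length at least `hbar`,
brings the delayed arguments of the second interval `[b, e]` under control; over the latter, agent
`i` collects at least the fraction `ε` of the bound of agent `j`. -/
theorem IsSolution.le_of_arc (hA : AdmissibleWeights A)
    (hh : AdmissibleDelays hbar h) (hx : IsSolution A hbar h tstar x) (h0 : 0 ≤ tstar)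
    {a b e : ℝ} (ha : tstar ≤ a) (hab : hbar ≤ b - a) (hbe : b ≤ e) (hbar0 : 0 ≤ hbar)
    (hnn : ∀ s, a - hbar ≤ s → ∀ j, 0 ≤ x s j) {L : ℝ}
    (hL₁ : ∀ i, ∫ s in a..b, totalWeight A i s ≤ L) (hL₂ : ∀ i, ∫ s in b..e, totalWeight A i s ≤ L)
    {i j : V} (hij : j ≠ i) {ε : ℝ} (hε : ε ≤ ∫ s in b..e, A s i j)
    {c : ℝ} (hc0 : 0 ≤ c) (hc : c ≤ x a j) :
    Real.exp (-L) * (ε * (Real.exp (-L) * (Real.exp (-L) * c))) ≤ x e i := by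
  have hL0 : 0 ≤ L := by
    refine le_trans ?_ (hL₂ j)
    exact intervalIntegral.integral_nonneg hbe fun s hs => Finset.sum_nonneg fun k _ =>
      hA.nonneg s (by linarith [hs.1]) j k
  have hexp : Real.exp (-L) ≤ 1 := Real.exp_le_one_iff.2 (by linarith)
  set q := Real.exp (-L) with hq
  have hq0 : 0 < q := Real.exp_pos _
  have hab' : a ≤ b := by linarith
  -- the bound holds for agent `j` on the whole of `[a, e]`
  have hj₁ : ∀ s ∈ Icc a b, q * c ≤ x s j := fun s hs =>
    hx.exp_neg_mul_le hA hh h0 ha hnn (hL₁ j) hbar0 hc hs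
  have hnn' : ∀ s, b - hbar ≤ s → ∀ k, 0 ≤ x s k := fun s hs => hnn s (by linarith)
  have hj₂ : ∀ s ∈ Icc b e, q * (q * c) ≤ x s j := fun s hs =>
    hx.exp_neg_mul_le hA hh h0 (ha.trans hab') hnn' (hL₂ j) hbar0
      (hj₁ b (right_mem_Icc.2 hab')) hs
  have hj : ∀ s ∈ Icc (b - hbar) e, q * (q * c) ≤ x s j := fun s hs => by
    rcases le_total s b with hsb | hsb
    · refine le_trans ?_ (hj₁ s ⟨by linarith [hs.1], hsb⟩)
      exact mul_le_of_le_one_left (by positivity) hexp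
    · exact hj₂ s ⟨hsb, hs.2⟩
  have hmain := hx.add_sum_mul_integral_le hA hh h0 (ha.trans hab') hbe
    (c := fun k => if k = j then q * (q * c) else 0)
    (fun k => by split_ifs <;> positivity)
    (fun s hs k => by
      split_ifs with hk
      · exact hk ▸ hj s hs
      · exact hnn' s hs.1 k) i
  have hsum : ∑ k ∈ Finset.univ.erase i, (if k = j then q * (q * c) else 0) *
      ∫ s in b..e, A s i k = q * (q * c) * ∫ s in b..e, A s i j := by
    rw [Finset.sum_eq_single_of_mem j (by simpa using hij)]
    · simp
    · intro k _ hk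
      simp [hk]
  rw [hsum] at hmain
  have hxe : 0 ≤ x e i := hnn e (by linarith) i
  have hxb : 0 ≤ x b i := hnn b (by linarith) i
  have h1 : ε * (q * (q * c)) ≤ Real.exp L * x e i := by
    have h2 : Real.exp (∫ s in b..e, totalWeight A i s) * x e i ≤ Real.exp L * x e i :=
      mul_le_mul_of_nonneg_right (Real.exp_le_exp.2 (hL₂ i)) hxe
    have h3 : (q * (q * c)) * ε ≤ (q * (q * c)) * ∫ s in b..e, A s i j :=
      mul_le_mul_of_nonneg_left hε (by positivity)
    linarith
  rw [hq, Real.exp_neg, inv_mul_le_iff₀ (Real.exp_pos L), ← Real.exp_neg, ← hq]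
  exact h1

end Dynamics

/-! ### Spreading of bounds over the graph -/

theorem exists_adj_of_reflTransGen {V : Type*} {R : V → V → Prop} {S : Set V} {a b : V}
    (hab : Relation.ReflTransGen R a b) (ha : a ∈ S) (hb : b ∉ S) :
    ∃ j ∈ S, ∃ i ∉ S, R j i := by
  induction hab with
  | refl => exact absurd ha hb
  | @tail c d _ hcd ih =>
    by_cases hc : c ∈ S
    · exact ⟨c, hc, d, hb, hcd⟩
    · exact ih hc

theorem le_of_adj_truncate {V : Type*} {W : Matrix V V ℝ} {ε : ℝ} {j i : V}
    (hadj : (graphOf (truncate ε W)).Adj j i) : ε ≤ W i j := by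
  by_contra hlt
  have h0 : 0 < if ε ≤ W i j then W i j else 0 := hadj
  simp [hlt] at h0

section Spreading

variable {V : Type*} [Fintype V] [DecidableEq V] {A : ℝ → Matrix V V ℝ} {hbar : ℝ}
  {h : ℝ → V → V → ℝ} {tstar : ℝ} {x y : ℝ → V → ℝ} {t : ℕ → ℝ} {ε L : ℝ}

theorem IsSeqBounded.exists_totalWeight_le (hA : AdmissibleWeights A) (ht : ∀ p, 0 ≤ t p)
    (hb : IsSeqBounded A t) : ∃ L, ∀ p i, ∫ s in (t p)..(t (p + 1)), totalWeight A i s ≤ L := by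
  obtain ⟨l, hl⟩ := hb
  refine ⟨(Fintype.card V - 1) • l, fun p i => ?_⟩
  rw [integral_totalWeight hA (ht p) (ht _)]
  have h1 := Finset.sum_le_card_nsmul (Finset.univ.erase i)
    (fun j => ∫ s in (t p)..(t (p + 1)), A s i j) l
    (fun j hj => hl p i j (Finset.ne_of_mem_erase hj).symm)
  rwa [Finset.card_erase_of_mem (Finset.mem_univ i)] at h1

theorem nonneg_of_totalWeight_le (hA : AdmissibleWeights A) (ht : IsAQSCSequence A ε t)
    (hL : ∀ p i, ∫ s in (t p)..(t (p + 1)), totalWeight A i s ≤ L) : 0 ≤ L := by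
  obtain ⟨i, -⟩ := ht.connected 0
  refine le_trans ?_ (hL 0 i)
  exact intervalIntegral.integral_nonneg (ht.strictMono (Nat.lt_succ_self 0)).le fun s hs =>
    Finset.sum_nonneg fun k _ => hA.nonneg s ((ht.nonneg 0).trans hs.1) i k

/-- The fraction of a lower bound that survives two consecutive intervals, for the agents that had
the bound and for the agents that are reached by an arc of the second interval. -/
noncomputable def spreadFactor (ε L : ℝ) : ℝ :=
  Real.exp (-L) * (Real.exp (-L) * (Real.exp (-L) * min 1 ε))

theorem spreadFactor_pos (hε : 0 < ε) : 0 < spreadFactor ε L := by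
  have := Real.exp_pos (-L)
  have : 0 < min 1 ε := lt_min one_pos hε
  unfold spreadFactor
  positivity

theorem spreadFactor_le_one (hε : 0 < ε) (hL : 0 ≤ L) : spreadFactor ε L ≤ 1 := by
  have h1 : Real.exp (-L) ≤ 1 := Real.exp_le_one_iff.2 (by linarith)
  have h0 := Real.exp_pos (-L)
  have h2 : 0 ≤ min 1 ε := (lt_min one_pos hε).le
  exact mul_le_one₀ h1 (by positivity)
    (mul_le_one₀ h1 (by positivity) (mul_le_one₀ h1 h2 (min_le_left _ _)))

/-- Over two consecutive intervals, the set of agents that obey a lower bound does not lose members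
(when the bound is reduced by `spreadFactor`), and it gains one if it contains the root of the
second interval and is not yet the set of all agents. -/
theorem IsSolution.exists_spread (hA : AdmissibleWeights A) (hbar0 : 0 ≤ hbar)
    (hh : AdmissibleDelays hbar h) (hy : IsSolution A hbar h tstar y) (h0 : 0 ≤ tstar)
    (ht : IsAQSCSequence A ε t) (hstep : ∀ p, hbar ≤ t (p + 1) - t p)
    (hL : ∀ p i, ∫ s in (t p)..(t (p + 1)), totalWeight A i s ≤ L)
    {p : ℕ} (hp : tstar ≤ t p) (hnn : ∀ s, t p - hbar ≤ s → ∀ j, 0 ≤ y s j)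
    {root : V} (hroot : ∀ i, Relation.ReflTransGen
      (graphOf (truncate ε (integralMatrix A (t (p + 1)) (t (p + 2))))).Adj root i)
    {S : Finset V} {c : ℝ} (hc : 0 ≤ c) (hS : ∀ i ∈ S, c ≤ y (t p) i) :
    ∃ S' : Finset V, S ⊆ S' ∧ (∀ i ∈ S', spreadFactor ε L * c ≤ y (t (p + 2)) i) ∧
      (root ∈ S → S ≠ Finset.univ → S.card < S'.card) := by
  have hε := ht.eps_pos
  have hL0 : 0 ≤ L := nonneg_of_totalWeight_le hA ht hL
  have hq1 : Real.exp (-L) ≤ 1 := Real.exp_le_one_iff.2 (by linarith)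
  have hq0 := Real.exp_pos (-L)
  have hmin0 : 0 ≤ min 1 ε := (lt_min one_pos hε).le
  have h12 : t p ≤ t (p + 1) := (ht.strictMono (Nat.lt_succ_self _)).le
  have h23 : t (p + 1) ≤ t (p + 2) := (ht.strictMono (Nat.lt_succ_self _)).le
  have hkeep : ∀ i ∈ S, spreadFactor ε L * c ≤ y (t (p + 2)) i := by
    intro i hi
    have h1 := hy.exp_neg_mul_le hA hh h0 hp hnn (hL p i) hbar0 (hS i hi) (right_mem_Icc.2 h12)
    have h2 := hy.exp_neg_mul_le hA hh h0 (hp.trans h12) (fun s hs => hnn s (by linarith))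
      (hL (p + 1) i) hbar0 h1 (right_mem_Icc.2 h23)
    refine le_trans ?_ h2
    have h3 : Real.exp (-L) * min 1 ε ≤ 1 := mul_le_one₀ hq1 hmin0 (min_le_left _ _)
    calc spreadFactor ε L * c
        = Real.exp (-L) * (Real.exp (-L) * ((Real.exp (-L) * min 1 ε) * c)) := by
          unfold spreadFactor; ring
      _ ≤ Real.exp (-L) * (Real.exp (-L) * (1 * c)) := by gcongr
      _ = Real.exp (-L) * (Real.exp (-L) * c) := by ring
  by_cases hgrow : root ∈ S ∧ S ≠ Finset.univ
  · obtain ⟨k, hk⟩ : ∃ k, k ∉ S := by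
      by_contra! hall
      exact hgrow.2 (Finset.eq_univ_iff_forall.2 hall)
    obtain ⟨j, hj, i, hi, hadj⟩ := exists_adj_of_reflTransGen (S := (S : Set V)) (hroot k)
      (by simpa using hgrow.1) (by simpa using hk)
    have hj' : j ∈ S := by simpa using hj
    have hi' : i ∉ S := by simpa using hi
    have hji : j ≠ i := fun hji => hi' (hji ▸ hj')
    refine ⟨insert i S, Finset.subset_insert _ _, ?_, fun _ _ => ?_⟩
    · intro l hl
      rcases Finset.mem_insert.1 hl with rfl | hl
      · have hint : min 1 ε ≤ ∫ s in (t (p + 1))..(t (p + 2)), A s l j :=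
          (min_le_right _ _).trans (le_of_adj_truncate hadj)
        refine le_of_eq_of_le ?_ (hy.le_of_arc hA hh h0 hp (hstep p) h23 hbar0 hnn (hL p)
          (hL (p + 1)) hji hint hc (hS j hj'))
        unfold spreadFactor
        ring
      · exact hkeep l hl
    · rw [Finset.card_insert_of_notMem hi']
      exact Nat.lt_succ_self _
  · exact ⟨S, subset_rfl, hkeep, fun h1 h2 => absurd ⟨h1, h2⟩ hgrow⟩

/-- Let every agent obey one of two lower bounds, for the nonnegative solutions `x` and `y`. In
every interval the root belongs to one of the two sets of agents, so one of them grows until one of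
them is the set of all agents; since the two sets cover `V`, this takes at most `n - 1` rounds of
two intervals. -/
theorem IsSolution.forall_le_or_forall_le (hA : AdmissibleWeights A) (hbar0 : 0 ≤ hbar)
    (hh : AdmissibleDelays hbar h) (hx : IsSolution A hbar h tstar x)
    (hy : IsSolution A hbar h tstar y) (h0 : 0 ≤ tstar)
    (ht : IsAQSCSequence A ε t) (hstep : ∀ p, hbar ≤ t (p + 1) - t p)
    (hL : ∀ p i, ∫ s in (t p)..(t (p + 1)), totalWeight A i s ≤ L)
    {r : ℕ} (hr : tstar ≤ t r) (hxnn : ∀ s, t r - hbar ≤ s → ∀ j, 0 ≤ x s j)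
    (hynn : ∀ s, t r - hbar ≤ s → ∀ j, 0 ≤ y s j) {c : ℝ} (hc : 0 ≤ c)
    (hxy : ∀ i, c ≤ x (t r) i ∨ c ≤ y (t r) i) :
    (∀ i, spreadFactor ε L ^ (Fintype.card V - 1) * c ≤
        x (t (r + 2 * (Fintype.card V - 1))) i) ∨
      (∀ i, spreadFactor ε L ^ (Fintype.card V - 1) * c ≤
        y (t (r + 2 * (Fintype.card V - 1))) i) := by
  set κ := spreadFactor ε L with hκ
  have hκ0 : 0 < κ := spreadFactor_pos ht.eps_pos
  have key : ∀ k : ℕ, ∃ S T : Finset V, S ∪ T = Finset.univ ∧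
      (∀ i ∈ S, κ ^ k * c ≤ x (t (r + 2 * k)) i) ∧
      (∀ i ∈ T, κ ^ k * c ≤ y (t (r + 2 * k)) i) ∧
      (S = Finset.univ ∨ T = Finset.univ ∨ Fintype.card V + k ≤ S.card + T.card) := by
    intro k
    induction k with
    | zero =>
      refine ⟨Finset.univ.filter fun i => c ≤ x (t r) i, Finset.univ.filter fun i => c ≤ y (t r) i,
        ?_, by simp, by simp, Or.inr (Or.inr ?_)⟩
      · rw [← Finset.filter_or]
        exact Finset.filter_true_of_mem fun i _ => hxy i
      · refine le_trans (le_of_eq ?_) (Finset.card_union_le _ _)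
        rw [← Finset.filter_or, Finset.filter_true_of_mem fun i _ => hxy i, add_zero,
          Finset.card_univ]
    | succ k ih =>
      obtain ⟨S, T, hST, hS, hT, hcard⟩ := ih
      have hmono : t r ≤ t (r + 2 * k) := ht.strictMono.monotone (by omega)
      obtain ⟨root, hroot⟩ := ht.connected (r + 2 * k + 1)
      have hck : 0 ≤ κ ^ k * c := by positivity
      obtain ⟨S', hSS, hS', hSc⟩ := hx.exists_spread hA hbar0 hh h0 ht hstep hL (hr.trans hmono)
        (fun s hs => hxnn s (by linarith)) hroot hck hS
      obtain ⟨T', hTT, hT', hTc⟩ := hy.exists_spread hA hbar0 hh h0 ht hstep hL (hr.trans hmono)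
        (fun s hs => hynn s (by linarith)) hroot hck hT
      refine ⟨S', T', ?_, ?_, ?_, ?_⟩
      · exact Finset.eq_univ_of_forall fun i => Finset.union_subset_union hSS hTT
          (hST ▸ Finset.mem_univ i)
      · intro i hi
        rw [pow_succ', mul_assoc]
        exact hS' i hi
      · intro i hi
        rw [pow_succ', mul_assoc]
        exact hT' i hi
      · rcases hcard with hu | hu | hcard
        · exact Or.inl (Finset.univ_subset_iff.1 (hu ▸ hSS))
        · exact Or.inr (Or.inl (Finset.univ_subset_iff.1 (hu ▸ hTT)))
        · by_cases hSu : S = Finset.univ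
          · exact Or.inl (Finset.univ_subset_iff.1 (hSu ▸ hSS))
          by_cases hTu : T = Finset.univ
          · exact Or.inr (Or.inl (Finset.univ_subset_iff.1 (hTu ▸ hTT)))
          refine Or.inr (Or.inr ?_)
          have h1 := Finset.card_le_card hSS
          have h2 := Finset.card_le_card hTT
          have hmem : root ∈ S ∪ T := hST ▸ Finset.mem_univ root
          rcases Finset.mem_union.1 hmem with hm | hm
          · have := hSc hm hSu
            omega
          · have := hTc hm hTu
            omega
  obtain ⟨S, T, -, hS, hT, hcard⟩ := key (Fintype.card V - 1)
  have hu : S = Finset.univ ∨ T = Finset.univ := by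
    by_contra! hne
    have h1 := (Finset.card_lt_iff_ne_univ S).2 hne.1
    have h2 := (Finset.card_lt_iff_ne_univ T).2 hne.2
    rcases hcard with hcard | hcard | hcard
    · exact hne.1 hcard
    · exact hne.2 hcard
    · omega
  rcases hu with hu | hu
  · exact Or.inl fun i => hS i (hu ▸ Finset.mem_univ i)
  · exact Or.inr fun i => hT i (hu ▸ Finset.mem_univ i)

end Spreading

/-! ### Windows, and contraction of the diameter -/

theorem diameter_le_pow_mul {V : Type*} {hbar tstar : ℝ} {x : ℝ → V → ℝ} {t : ℕ → ℝ} {θ : ℝ}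
    (hθ : 0 ≤ θ) {m : ℕ}
    (hone : ∀ r, tstar ≤ t r → diameter hbar x (t (r + m)) ≤ θ * diameter hbar x (t r))
    (ht : Monotone t) {r : ℕ} (hr : tstar ≤ t r) (k : ℕ) :
    diameter hbar x (t (r + k * m)) ≤ θ ^ k * diameter hbar x (t r) := by
  induction k with
  | zero => simp
  | succ k ih =>
    have h1 := hone (r + k * m) (hr.trans (ht (Nat.le_add_right _ _)))
    rw [Nat.succ_mul, ← add_assoc, pow_succ', mul_assoc]
    exact h1.trans (mul_le_mul_of_nonneg_left ih hθ)

section Windows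

variable {V : Type*} [Fintype V] [DecidableEq V] {A : ℝ → Matrix V V ℝ} {hbar : ℝ}
  {h : ℝ → V → V → ℝ} {tstar : ℝ} {x : ℝ → V → ℝ} {t : ℕ → ℝ} {ε L : ℝ}

theorem IsSolution.exists_abs_le (hx : IsSolution A hbar h tstar x) {a : ℝ} (ha : tstar ≤ a) :
    ∃ C, ∀ s ∈ Icc (a - hbar) a, ∀ i, |x s i| ≤ C := by
  obtain ⟨C, hC⟩ := hx.history_bounded
  have hD : ∀ i, ∃ D, ∀ s ∈ Icc tstar a, |x s i| ≤ D := fun i =>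
    isCompact_Icc.exists_bound_of_continuousOn (hx.continuousOn ha i)
  choose D hD using hD
  refine ⟨max C (∑ i, |D i|), fun s hs i => ?_⟩
  rcases lt_or_ge s tstar with hlt | hge
  · exact (hC s ⟨by linarith [hs.1], hlt⟩ i).trans (le_max_left _ _)
  · refine le_trans ?_ (le_max_right _ _)
    exact ((hD i s ⟨hge, hs.2⟩).trans (le_abs_self _)).trans
      (Finset.single_le_sum (f := fun i => |D i|) (fun j _ => abs_nonneg _) (Finset.mem_univ i))

theorem IsSolution.windowInf_le_of_mem (hx : IsSolution A hbar h tstar x) {a : ℝ}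
    (ha : tstar ≤ a) {s : ℝ} (hs : s ∈ Icc (a - hbar) a) (i : V) : windowInf hbar x a ≤ x s i := by
  obtain ⟨C, hC⟩ := hx.exists_abs_le ha
  refine csInf_le ⟨-C, ?_⟩ ⟨s, hs, i, rfl⟩
  rintro _ ⟨s', hs', j, rfl⟩
  exact neg_le_of_abs_le (hC s' hs' j)

theorem IsSolution.le_windowSup_of_mem (hx : IsSolution A hbar h tstar x) {a : ℝ}
    (ha : tstar ≤ a) {s : ℝ} (hs : s ∈ Icc (a - hbar) a) (i : V) : x s i ≤ windowSup hbar x a := by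
  obtain ⟨C, hC⟩ := hx.exists_abs_le ha
  refine le_csSup ⟨C, ?_⟩ ⟨s, hs, i, rfl⟩
  rintro _ ⟨s', hs', j, rfl⟩
  exact le_of_abs_le (hC s' hs' j)

theorem le_windowInf {V : Type*} [Nonempty V] {hbar : ℝ} (hbar0 : 0 ≤ hbar) {x : ℝ → V → ℝ}
    {a c : ℝ} (hc : ∀ s ∈ Icc (a - hbar) a, ∀ i, c ≤ x s i) : c ≤ windowInf hbar x a := by
  obtain ⟨i⟩ := ‹Nonempty V›
  refine le_csInf ⟨x a i, a, ⟨by linarith, le_rfl⟩, i, rfl⟩ ?_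
  rintro _ ⟨s, hs, j, rfl⟩
  exact hc s hs j

theorem windowSup_le {V : Type*} [Nonempty V] {hbar : ℝ} (hbar0 : 0 ≤ hbar) {x : ℝ → V → ℝ}
    {a c : ℝ} (hc : ∀ s ∈ Icc (a - hbar) a, ∀ i, x s i ≤ c) : windowSup hbar x a ≤ c := by
  obtain ⟨i⟩ := ‹Nonempty V›
  refine csSup_le ⟨x a i, a, ⟨by linarith, le_rfl⟩, i, rfl⟩ ?_
  rintro _ ⟨s, hs, j, rfl⟩
  exact hc s hs j

theorem IsSolution.windowInf_le (hA : AdmissibleWeights A) (hbar0 : 0 ≤ hbar)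
    (hh : AdmissibleDelays hbar h) (hx : IsSolution A hbar h tstar x) (h0 : 0 ≤ tstar)
    {a : ℝ} (ha : tstar ≤ a) {s : ℝ} (hs : a - hbar ≤ s) (i : V) :
    windowInf hbar x a ≤ x s i := by
  have := (hx.affine 1 (-windowInf hbar x a)).nonneg_of_window hA hbar0 hh h0 ha
    (fun r hr j => by linarith [hx.windowInf_le_of_mem ha hr j]) hs i
  linarith

theorem IsSolution.le_windowSup (hA : AdmissibleWeights A) (hbar0 : 0 ≤ hbar)
    (hh : AdmissibleDelays hbar h) (hx : IsSolution A hbar h tstar x) (h0 : 0 ≤ tstar)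
    {a : ℝ} (ha : tstar ≤ a) {s : ℝ} (hs : a - hbar ≤ s) (i : V) :
    x s i ≤ windowSup hbar x a := by
  have := (hx.affine (-1) (windowSup hbar x a)).nonneg_of_window hA hbar0 hh h0 ha
    (fun r hr j => by linarith [hx.le_windowSup_of_mem ha hr j]) hs i
  linarith

variable [Nonempty V]

theorem IsSolution.windowInf_mono (hA : AdmissibleWeights A) (hbar0 : 0 ≤ hbar)
    (hh : AdmissibleDelays hbar h) (hx : IsSolution A hbar h tstar x) (h0 : 0 ≤ tstar)
    {a b : ℝ} (ha : tstar ≤ a) (hab : a ≤ b) : windowInf hbar x a ≤ windowInf hbar x b :=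
  le_windowInf hbar0 fun _ hs i => hx.windowInf_le hA hbar0 hh h0 ha (by linarith [hs.1]) i

theorem IsSolution.windowSup_anti (hA : AdmissibleWeights A) (hbar0 : 0 ≤ hbar)
    (hh : AdmissibleDelays hbar h) (hx : IsSolution A hbar h tstar x) (h0 : 0 ≤ tstar)
    {a b : ℝ} (ha : tstar ≤ a) (hab : a ≤ b) : windowSup hbar x b ≤ windowSup hbar x a :=
  windowSup_le hbar0 fun _ hs i => hx.le_windowSup hA hbar0 hh h0 ha (by linarith [hs.1]) i

theorem IsSolution.diameter_anti (hA : AdmissibleWeights A) (hbar0 : 0 ≤ hbar)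
    (hh : AdmissibleDelays hbar h) (hx : IsSolution A hbar h tstar x) (h0 : 0 ≤ tstar)
    {a b : ℝ} (ha : tstar ≤ a) (hab : a ≤ b) : diameter hbar x b ≤ diameter hbar x a :=
  sub_le_sub (hx.windowSup_anti hA hbar0 hh h0 ha hab) (hx.windowInf_mono hA hbar0 hh h0 ha hab)

theorem IsSolution.windowInf_le_windowSup (hbar0 : 0 ≤ hbar) (hx : IsSolution A hbar h tstar x)
    {a : ℝ} (ha : tstar ≤ a) : windowInf hbar x a ≤ windowSup hbar x a := by
  obtain ⟨i⟩ := ‹Nonempty V›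
  have ha' : a ∈ Icc (a - hbar) a := ⟨by linarith, le_rfl⟩
  exact (hx.windowInf_le_of_mem ha ha' i).trans (hx.le_windowSup_of_mem ha ha' i)

/-- The ratio by which the diameter shrinks over one block of intervals. -/
noncomputable def contractionFactor (ε L : ℝ) (n : ℕ) : ℝ :=
  1 - Real.exp (-L) * spreadFactor ε L ^ (n - 1) / 2

theorem contractionFactor_mem_Ioo {n : ℕ} (hε : 0 < ε) (hL : 0 ≤ L) :
    contractionFactor ε L n ∈ Ioo (0 : ℝ) 1 := by
  have h0 : 0 < spreadFactor ε L := spreadFactor_pos hε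
  have h1 : spreadFactor ε L ^ (n - 1) ≤ 1 := pow_le_one₀ h0.le (spreadFactor_le_one hε hL)
  have h2 : Real.exp (-L) ≤ 1 := Real.exp_le_one_iff.2 (by linarith)
  have h3 : Real.exp (-L) * spreadFactor ε L ^ (n - 1) ≤ 1 := mul_le_one₀ h2 (by positivity) h1
  have h4 : 0 < Real.exp (-L) * spreadFactor ε L ^ (n - 1) := by positivity
  unfold contractionFactor
  exact ⟨by linarith, by linarith⟩

/-- After `2 (n - 1)` intervals all agents keep away from one end of the initial range, and the
window of length `hbar` needs at most one more interval to follow. -/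
theorem IsSolution.diameter_le_contractionFactor_mul (hA : AdmissibleWeights A) (hbar0 : 0 ≤ hbar)
    (hh : AdmissibleDelays hbar h) (hx : IsSolution A hbar h tstar x) (h0 : 0 ≤ tstar)
    (ht : IsAQSCSequence A ε t) (hstep : ∀ p, hbar ≤ t (p + 1) - t p)
    (hL : ∀ p i, ∫ s in (t p)..(t (p + 1)), totalWeight A i s ≤ L) {m : ℕ}
    (hm : m = 2 * (Fintype.card V - 1) + 1 ∨ m = 2 * (Fintype.card V - 1) ∧ hbar = 0)
    {r : ℕ} (hr : tstar ≤ t r) :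
    diameter hbar x (t (r + m)) ≤
      contractionFactor ε L (Fintype.card V) * diameter hbar x (t r) := by
  set lo := windowInf hbar x (t r) with hlo
  set up := windowSup hbar x (t r) with hup
  set e := r + 2 * (Fintype.card V - 1) with he
  set f := t (r + m) with hf
  have hmono := ht.strictMono.monotone
  have hre : t r ≤ t e := hmono (by omega)
  have hrf : t r ≤ f := hmono (by omega)
  have hfe : t e ≤ f - hbar := by
    rcases hm with rfl | ⟨rfl, hz⟩
    · have := hstep e
      rw [hf, ← add_assoc]
      linarith
    · rw [hz, sub_zero]
  have hfe' : f ≤ t (e + 1) := hmono (by omega)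
  have hlu : lo ≤ up := hx.windowInf_le_windowSup hbar0 hr
  have hlow : ∀ s, t r - hbar ≤ s → ∀ i, 0 ≤ 1 * x s i + -lo := fun s hs i => by
    linarith [hx.windowInf_le hA hbar0 hh h0 hr hs i]
  have hupp : ∀ s, t r - hbar ≤ s → ∀ i, 0 ≤ -1 * x s i + up := fun s hs i => by
    linarith [hx.le_windowSup hA hbar0 hh h0 hr hs i]
  have hinf : lo ≤ windowInf hbar x f := hx.windowInf_mono hA hbar0 hh h0 hr hrf
  have hsup : windowSup hbar x f ≤ up := hx.windowSup_anti hA hbar0 hh h0 hr hrf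
  -- each agent is on one side of the midpoint of the initial range
  have hmid : ∀ i, (up - lo) / 2 ≤ 1 * x (t r) i + -lo ∨ (up - lo) / 2 ≤ -1 * x (t r) i + up := by
    intro i
    rcases le_total ((up + lo) / 2) (x (t r) i) with h1 | h1
    · exact Or.inl (by linarith)
    · exact Or.inr (by linarith)
  have hhalf : Real.exp (-L) * (spreadFactor ε L ^ (Fintype.card V - 1) * ((up - lo) / 2)) =
      (1 - contractionFactor ε L (Fintype.card V)) * (up - lo) := by
    unfold contractionFactor
    ring
  have hmem : ∀ s ∈ Icc (f - hbar) f, s ∈ Icc (t e) (t (e + 1)) := fun s hs =>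
    ⟨hfe.trans hs.1, hs.2.trans hfe'⟩
  unfold diameter
  rcases (hx.affine 1 (-lo)).forall_le_or_forall_le hA hbar0 hh (hx.affine (-1) up) h0 ht hstep hL
    hr hlow hupp (by linarith) hmid with hall | hall
  · have : lo + (1 - contractionFactor ε L (Fintype.card V)) * (up - lo) ≤
        windowInf hbar x f := le_windowInf hbar0 fun s hs i => by
      have := (hx.affine 1 (-lo)).exp_neg_mul_le hA hh h0 (hr.trans hre)
        (fun s hs => hlow s (by linarith)) (hL e i) hbar0 (hall i) (hmem s hs)
      linarith
    linarith
  · have : windowSup hbar x f ≤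
        up - (1 - contractionFactor ε L (Fintype.card V)) * (up - lo) :=
      windowSup_le hbar0 fun s hs i => by
        have := (hx.affine (-1) up).exp_neg_mul_le hA hh h0 (hr.trans hre)
          (fun s hs => hupp s (by linarith)) (hL e i) hbar0 (hall i) (hmem s hs)
        linarith
    linarith

/-- Geometric decay of the diameter block by block is all that contraction needs: the window bounds
are monotone, so they converge, to the same value, and enclose their common limit. -/
theorem contractsAlong_of_diameter_le (hA : AdmissibleWeights A) (hbar0 : 0 ≤ hbar)
    (hh : AdmissibleDelays hbar h) (htm : Monotone t) (htt : Tendsto t atTop atTop) {θ : ℝ}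
    (hθ : θ ∈ Ioo (0 : ℝ) 1) {m : ℕ}
    (hone : ∀ tstar, 0 ≤ tstar → ∀ x, IsSolution A hbar h tstar x → ∀ r, tstar ≤ t r →
      diameter hbar x (t (r + m)) ≤ θ * diameter hbar x (t r)) :
    ContractsAlong A hbar h t θ m := by
  intro tstar h0 x hx
  have hpow : ∀ r, tstar ≤ t r → ∀ k s, t (r + k * m) ≤ s →
      diameter hbar x s ≤ θ ^ k * diameter hbar x tstar := fun r hr k s hs => by
    have h1 : diameter hbar x s ≤ diameter hbar x (t (r + k * m)) :=
      hx.diameter_anti hA hbar0 hh h0 (hr.trans (htm (Nat.le_add_right _ _))) hs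
    have h2 := diameter_le_pow_mul hθ.1.le (hone tstar h0 x hx) htm hr k
    have h3 := hx.diameter_anti hA hbar0 hh h0 le_rfl hr
    exact h1.trans (h2.trans (mul_le_mul_of_nonneg_left h3 (pow_nonneg hθ.1.le k)))
  have hdiam0 : ∀ s, tstar ≤ s → 0 ≤ diameter hbar x s := fun s hs =>
    sub_nonneg.2 (hx.windowInf_le_windowSup hbar0 hs)
  have hdiam : Tendsto (diameter hbar x) atTop (𝓝 0) := by
    obtain ⟨r, hr⟩ := (htt.eventually_ge_atTop tstar).exists
    have hgeo : Tendsto (fun k : ℕ => θ ^ k * diameter hbar x tstar) atTop (𝓝 0) := by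
      simpa using (tendsto_pow_atTop_nhds_zero_of_lt_one hθ.1.le hθ.2).mul_const
        (diameter hbar x tstar)
    refine tendsto_order.2 ⟨fun a ha => ?_, fun a ha => ?_⟩
    · filter_upwards [eventually_ge_atTop tstar] with s hs
      exact ha.trans_le (hdiam0 s hs)
    · obtain ⟨k, hk⟩ := (hgeo.eventually_lt_const ha).exists
      filter_upwards [eventually_ge_atTop (t (r + k * m))] with s hs
      exact (hpow r hr k s hs).trans_lt hk
  -- the common value is the supremum of the lower window bounds
  set c := sSup (windowInf hbar x '' Ici tstar) with hc
  have hcross : ∀ a, tstar ≤ a → ∀ b, tstar ≤ b → windowInf hbar x a ≤ windowSup hbar x b := by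
    intro a ha b hb
    calc windowInf hbar x a ≤ windowInf hbar x (max a b) :=
          hx.windowInf_mono hA hbar0 hh h0 ha (le_max_left _ _)
      _ ≤ windowSup hbar x (max a b) :=
          hx.windowInf_le_windowSup hbar0 (ha.trans (le_max_left _ _))
      _ ≤ windowSup hbar x b := hx.windowSup_anti hA hbar0 hh h0 hb (le_max_right _ _)
  have hclow : ∀ s, tstar ≤ s → windowInf hbar x s ≤ c := fun s hs => by
    refine le_csSup ⟨windowSup hbar x tstar, ?_⟩ ⟨s, hs, rfl⟩
    rintro _ ⟨a, ha, rfl⟩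
    exact hcross a ha tstar le_rfl
  have hcup : ∀ s, tstar ≤ s → c ≤ windowSup hbar x s := fun s hs => by
    refine csSup_le ⟨_, tstar, le_refl tstar, rfl⟩ ?_
    rintro _ ⟨a, ha, rfl⟩
    exact hcross a ha s hs
  have hdist : ∀ s, tstar ≤ s → ∀ i, |x s i - c| ≤ diameter hbar x s := fun s hs i => by
    have hs' : s ∈ Icc (s - hbar) s := ⟨by linarith, le_rfl⟩
    have h1 := hx.windowInf_le_of_mem hs hs' i
    have h2 := hx.le_windowSup_of_mem hs hs' i
    have h3 := hclow s hs
    have h4 := hcup s hs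
    unfold diameter
    exact abs_le.2 ⟨by linarith, by linarith⟩
  refine ⟨c, fun i => ?_, fun r hr k s hs => ⟨?_, hpow r hr k s hs.1⟩⟩
  · rw [tendsto_iff_norm_sub_tendsto_zero]
    refine squeeze_zero' (Eventually.of_forall fun _ => norm_nonneg _) ?_ hdiam
    filter_upwards [eventually_ge_atTop tstar] with s hs
    exact hdist s hs i
  · have hs' : tstar ≤ s := (hr.trans (htm (Nat.le_add_right _ _))).trans hs.1
    exact (pi_norm_le_iff_of_nonneg (hdiam0 s hs')).2 fun i => hdist s hs' i

end Windows

/-! ### Thinning out connectivity sequences -/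

section Thinning

variable {V : Type*} [Fintype V] {A : ℝ → Matrix V V ℝ} {hbar : ℝ} {t : ℕ → ℝ} {ε : ℝ}

theorem IsAQSCSequence.comp_mul {V : Type*} {A : ℝ → Matrix V V ℝ} {t : ℕ → ℝ} {ε : ℝ}
    (hA : AdmissibleWeights A) (ht : IsAQSCSequence A ε t) {N : ℕ}
    (hN : 0 < N) : IsAQSCSequence A ε (fun p => t (N * p)) where
  eps_pos := ht.eps_pos
  nonneg p := ht.nonneg _
  strictMono p q hpq := ht.strictMono (Nat.mul_lt_mul_of_pos_left hpq hN)
  tendsto := ht.tendsto.comp (tendsto_id.const_mul_atTop' hN)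
  connected p := by
    obtain ⟨root, hroot⟩ := ht.connected (N * p)
    refine ⟨root, fun i => Relation.ReflTransGen.mono ?_ root i (hroot i)⟩
    intro j i hadj
    have h1 : ε ≤ ∫ s in (t (N * p))..(t (N * p + 1)), A s i j := le_of_adj_truncate hadj
    have h2 : ε ≤ ∫ s in (t (N * p))..(t (N * (p + 1))), A s i j :=
      h1.trans (hA.integral_mono (ht.nonneg _) le_rfl (ht.strictMono.monotone (Nat.le_succ _))
        (ht.strictMono.monotone (by nlinarith)) i j)
    change 0 < if ε ≤ ∫ s in (t (N * p))..(t (N * (p + 1))), A s i j then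
      ∫ s in (t (N * p))..(t (N * (p + 1))), A s i j else 0
    rw [if_pos h2]
    exact ht.eps_pos.trans_le h2
  bounded := by
    obtain ⟨l, hl⟩ := ht.bounded
    refine ⟨N * l, fun p i j hij => ?_⟩
    have hsum := intervalIntegral.sum_integral_adjacent_intervals (f := fun s => A s i j)
      (μ := volume) (a := fun k => t (N * p + k)) (n := N)
      fun k _ => hA.intervalIntegrable (ht.nonneg _) (ht.nonneg _) i j
    have h1 := Finset.sum_le_card_nsmul (Finset.range N)
      (fun k => ∫ s in (t (N * p + k))..(t (N * p + (k + 1))), A s i j) l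
      fun k _ => hl (N * p + k) i j hij
    rw [Finset.card_range, nsmul_eq_mul] at h1
    simp only [add_zero] at hsum
    rwa [hsum] at h1

/-- Over every interval of an AQSC sequence the root has an outgoing arc of weight at least `ε`. -/
theorem IsAQSCSequence.le_sum_integral (hA : AdmissibleWeights A) (ht : IsAQSCSequence A ε t)
    (hn : 2 ≤ Fintype.card V) (p : ℕ) :
    ε ≤ ∑ i, ∑ j, ∫ s in (t p)..(t (p + 1)), A s i j := by
  obtain ⟨root, hroot⟩ := ht.connected p
  have : Nontrivial V := Fintype.one_lt_card_iff_nontrivial.1 hn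
  obtain ⟨k, hk⟩ := exists_ne root
  obtain ⟨j, -, i, -, hadj⟩ := exists_adj_of_reflTransGen (S := {root}) (hroot k) rfl hk
  have hnn : ∀ i j, 0 ≤ ∫ s in (t p)..(t (p + 1)), A s i j := fun i j =>
    intervalIntegral.integral_nonneg (ht.strictMono (Nat.lt_succ_self p)).le fun s hs =>
      hA.nonneg s ((ht.nonneg p).trans hs.1) i j
  refine (le_of_adj_truncate hadj).trans ?_
  refine le_trans ?_ (Finset.single_le_sum (f := fun i => ∑ j, ∫ s in (t p)..(t (p + 1)), A s i j)
    (fun i _ => Finset.sum_nonneg fun j _ => hnn i j) (Finset.mem_univ i))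
  exact Finset.single_le_sum (f := fun j => ∫ s in (t p)..(t (p + 1)), A s i j)
    (fun j _ => hnn i j) (Finset.mem_univ j)

/-- A time interval of length `hbar` carries a bounded total mass of the weights, whereas every
interval of the sequence carries at least `ε`; so boundedly many of them fit into it. -/
theorem IsAQSCSequence.exists_le_sub (hA : AdmissibleWeights A) (hbar0 : 0 ≤ hbar)
    (hbound : UniformIntegralBound A ∨ hbar = 0) (ht : IsAQSCSequence A ε t)
    (hn : 2 ≤ Fintype.card V) : ∃ N : ℕ, 0 < N ∧ ∀ q, hbar ≤ t (q + N) - t q := by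
  rcases hbound with hbound | rfl
  · -- the definition of the uniform bound needs a positive length, hence `hbar + 1`
    obtain ⟨μ, hμ⟩ := hbound (hbar + 1) (by linarith)
    obtain ⟨N, hN⟩ := exists_nat_gt ((∑ _i : V, ∑ _j : V, μ) / ε)
    rw [div_lt_iff₀ ht.eps_pos] at hN
    refine ⟨N + 1, Nat.succ_pos _, fun q => ?_⟩
    by_contra! hlt
    have hmass : ∀ k : ℕ, k * ε ≤ ∑ i, ∑ j, ∫ s in (t q)..(t (q + k)), A s i j := by
      intro k
      induction k with
      | zero => simp
      | succ k ih =>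
        have hadd : ∑ i, ∑ j, ∫ s in (t q)..(t (q + (k + 1))), A s i j =
            (∑ i, ∑ j, ∫ s in (t q)..(t (q + k)), A s i j) +
              ∑ i, ∑ j, ∫ s in (t (q + k))..(t (q + k + 1)), A s i j := by
          rw [← Finset.sum_add_distrib]
          refine Finset.sum_congr rfl fun i _ => ?_
          rw [← Finset.sum_add_distrib]
          refine Finset.sum_congr rfl fun j _ => ?_
          exact (intervalIntegral.integral_add_adjacent_intervals
            (hA.intervalIntegrable (ht.nonneg _) (ht.nonneg _) i j)
            (hA.intervalIntegrable (ht.nonneg _) (ht.nonneg _) i j)).symm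
        have := ht.le_sum_integral hA hn (q + k)
        rw [hadd, Nat.cast_succ, add_one_mul]
        exact add_le_add ih this
    have hup : ∑ i, ∑ j, ∫ s in (t q)..(t (q + (N + 1))), A s i j ≤ ∑ _i : V, ∑ _j : V, μ :=
      Finset.sum_le_sum fun i _ => Finset.sum_le_sum fun j _ =>
        (hA.integral_mono (ht.nonneg q) le_rfl (ht.strictMono.monotone (Nat.le_add_right _ _))
          (by linarith) i j).trans (hμ (t q) (ht.nonneg q) i j)
    have h1 := (hmass (N + 1)).trans hup
    push_cast at h1
    nlinarith [ht.eps_pos]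
  · exact ⟨1, one_pos, fun q => sub_nonneg.2 (ht.strictMono (Nat.lt_succ_self q)).le⟩

/-- A single agent is quasi-strongly connected over any sequence, for instance one with steps of
length `hbar + 1`. -/
theorem isAQSCSequence_of_card_eq_one (hbar0 : 0 ≤ hbar) (hn : Fintype.card V = 1) :
    IsAQSCSequence A 1 (fun p : ℕ => (p : ℝ) * (hbar + 1)) where
  eps_pos := one_pos
  nonneg p := by positivity
  strictMono p q hpq := mul_lt_mul_of_pos_right (Nat.cast_lt.2 hpq) (by linarith)
  tendsto := tendsto_natCast_atTop_atTop.atTop_mul_const (by linarith)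
  connected p := by
    obtain ⟨v, hv⟩ := Fintype.card_eq_one_iff.1 hn
    exact ⟨v, fun i => hv i ▸ Relation.ReflTransGen.refl⟩
  bounded := ⟨0, fun p i j hij =>
    absurd (Fintype.card_le_one_iff.1 hn.le i j) hij⟩

end Thinning

section Contraction

variable {V : Type*} [Fintype V] [DecidableEq V] {A : ℝ → Matrix V V ℝ} {hbar : ℝ}
  {h : ℝ → V → V → ℝ} {t : ℕ → ℝ} {ε : ℝ}

theorem IsAQSCSequence.nonempty {V : Type*} {A : ℝ → Matrix V V ℝ} {t : ℕ → ℝ} {ε : ℝ}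
    (ht : IsAQSCSequence A ε t) : Nonempty V :=
  (ht.connected 0).nonempty

/-- One factor serves all solutions. The sequence may be thinned out by `N`, provided that the
blocks of `m'` thinned intervals contain `m` original ones. -/
theorem IsAQSCSequence.exists_contractsAlong (hA : AdmissibleWeights A) (hbar0 : 0 ≤ hbar)
    (ht : IsAQSCSequence A ε t) (hstep : ∀ p, hbar ≤ t (p + 1) - t p) {m m' N : ℕ} (hN : 0 < N)
    (hm : m = 2 * (Fintype.card V - 1) + 1 ∨ m = 2 * (Fintype.card V - 1) ∧ hbar = 0)
    (hmm : m ≤ N * m') (hh : AdmissibleDelays hbar h) :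
    ∃ θ ∈ Ioo (0 : ℝ) 1, ContractsAlong A hbar h (fun p => t (N * p)) θ m' := by
  have := ht.nonempty
  obtain ⟨L, hL⟩ := ht.bounded.exists_totalWeight_le hA ht.nonneg
  have hθ := contractionFactor_mem_Ioo (n := Fintype.card V) ht.eps_pos
    (nonneg_of_totalWeight_le hA ht hL)
  have ht' := ht.comp_mul hA hN
  refine ⟨_, hθ, contractsAlong_of_diameter_le hA hbar0 hh ht'.strictMono.monotone ht'.tendsto hθ
    fun tstar h0 x hx r hr => ?_⟩
  refine le_trans ?_ (hx.diameter_le_contractionFactor_mul hA hbar0 hh h0 ht hstep hL hm hr)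
  refine hx.diameter_anti hA hbar0 hh h0 (hr.trans (ht.strictMono.monotone ?_))
    (ht.strictMono.monotone ?_)
  · exact Nat.le_add_right _ _
  · rw [mul_add]
    exact Nat.add_le_add_left hmm _

theorem ContractsAlong.establishesGlobalConsensus {θ : ℝ} {m : ℕ}
    (hc : ContractsAlong A hbar h t θ m) : EstablishesGlobalConsensus A hbar h := by
  intro tstar h0 x hx
  obtain ⟨c, hlim, -⟩ := hc tstar h0 x hx
  exact ⟨fun _ => c, fun i _ => hlim i, fun _ _ _ _ => rfl⟩

end Contraction

end DelayedConsensus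

theorem mainTheorem1 {V : Type*} [Fintype V] [DecidableEq V]
    (A : ℝ → Matrix V V ℝ) (hA : DelayedConsensus.AdmissibleWeights A)
    (hbar : ℝ) (hbar_nonneg : 0 ≤ hbar)
    (hbound : DelayedConsensus.UniformIntegralBound A ∨ hbar = 0)
    (hconn : DelayedConsensus.IsAQSC A) :
    -- global consensus, whatever the delays bounded by `hbar`
    (∀ h : ℝ → V → V → ℝ, DelayedConsensus.AdmissibleDelays hbar h →
      DelayedConsensus.EstablishesGlobalConsensus A hbar h) ∧
    (∀ (ε : ℝ) (t : ℕ → ℝ), DelayedConsensus.IsAQSCSequence A ε t →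
      -- contraction over blocks of `2(n-1)` intervals, along the sequence `t_0, t_N, t_2N, ...`
      (2 ≤ Fintype.card V →
        ∃ N : ℕ, 0 < N ∧
          DelayedConsensus.IsAQSCSequence A ε (fun p => t (N * p)) ∧
          (∀ p, hbar ≤ t (N * (p + 1)) - t (N * p)) ∧
          ∀ h : ℝ → V → V → ℝ, DelayedConsensus.AdmissibleDelays hbar h →
            ∃ θ ∈ Set.Ioo (0 : ℝ) 1,
              DelayedConsensus.ContractsAlong A hbar h (fun p => t (N * p)) θ
                (2 * (Fintype.card V - 1))) ∧
      -- contraction over blocks of `2n-1` intervals, along every sequence with steps `≥ hbar`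
      ((∀ p, hbar ≤ t (p + 1) - t p) →
        ∀ h : ℝ → V → V → ℝ, DelayedConsensus.AdmissibleDelays hbar h →
          ∃ θ ∈ Set.Ioo (0 : ℝ) 1,
            DelayedConsensus.ContractsAlong A hbar h t θ (2 * Fintype.card V - 1)) ∧
      -- without delays: contraction over blocks of `2(n-1)` intervals, along every sequence
      (hbar = 0 →
        ∀ h : ℝ → V → V → ℝ, DelayedConsensus.AdmissibleDelays hbar h →
          ∃ θ ∈ Set.Ioo (0 : ℝ) 1,
            DelayedConsensus.ContractsAlong A hbar h t θ (2 * (Fintype.card V - 1)))) := by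
  obtain ⟨ε₀, t₀, ht₀⟩ := hconn
  have hcard : 1 ≤ Fintype.card V := Fintype.card_pos_iff.2 ht₀.nonempty
  -- sequences with long steps: the blocks of `2n - 1` intervals
  have hlong : ∀ (ε : ℝ) (t : ℕ → ℝ), DelayedConsensus.IsAQSCSequence A ε t →
      (∀ p, hbar ≤ t (p + 1) - t p) → ∀ h, DelayedConsensus.AdmissibleDelays hbar h →
      ∃ θ ∈ Set.Ioo (0 : ℝ) 1,
        DelayedConsensus.ContractsAlong A hbar h t θ (2 * Fintype.card V - 1) := by
    intro ε t ht hstep h hh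
    simpa using ht.exists_contractsAlong hA hbar_nonneg hstep (m' := 2 * Fintype.card V - 1)
      one_pos (Or.inl rfl) (by omega) hh
  refine ⟨fun h hh => ?_, fun ε t ht => ⟨fun hn => ?_, hlong ε t ht, fun hz h hh => ?_⟩⟩
  · rcases hcard.eq_or_lt with hone | hn
    · obtain ⟨θ, -, hθ⟩ := hlong 1 _
        (DelayedConsensus.isAQSCSequence_of_card_eq_one hbar_nonneg hone.symm)
        (fun p => by push_cast; linarith) h hh
      exact hθ.establishesGlobalConsensus
    · obtain ⟨N, hN, hstep⟩ := ht₀.exists_le_sub hA hbar_nonneg hbound hn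
      obtain ⟨θ, -, hθ⟩ := hlong ε₀ _ (ht₀.comp_mul hA hN)
        (fun p => by simpa only [mul_add, mul_one] using hstep (N * p)) h hh
      exact hθ.establishesGlobalConsensus
  · -- `N` intervals last for `hbar`; merging `2 N` of them, `2 (n - 1)` merged intervals contain
    -- `4 (n - 1) ≥ 2 n - 1` groups of `N`
    obtain ⟨N, hN, hstep⟩ := ht.exists_le_sub hA hbar_nonneg hbound hn
    have htN := ht.comp_mul hA hN
    have hstepN : ∀ p, hbar ≤ t (N * (p + 1)) - t (N * p) := fun p => by
      simpa only [mul_add, mul_one] using hstep (N * p)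
    refine ⟨N * 2, by omega, ht.comp_mul hA (by omega), fun p => ?_, fun h hh => ?_⟩
    · have h1 := hstep (N * 2 * p)
      have h2 : t (N * 2 * p + N) ≤ t (N * 2 * (p + 1)) := ht.strictMono.monotone (by nlinarith)
      linarith
    · simpa only [mul_assoc] using htN.exists_contractsAlong hA hbar_nonneg hstepN
        (m' := 2 * (Fintype.card V - 1)) two_pos (Or.inl rfl) (by omega) hh
  · have hstep : ∀ p, hbar ≤ t (p + 1) - t p := fun p => by
      rw [hz]
      exact sub_nonneg.2 (ht.strictMono (Nat.lt_succ_self p)).le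
    simpa using ht.exists_contractsAlong hA hbar_nonneg hstep (m' := 2 * (Fintype.card V - 1))
      one_pos (Or.inr ⟨rfl, hz⟩) (by omega) hh
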